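/- Let $K$ be a field, $G$ a finite group, and $KG$ the group algebra. A $G$-code is a right ideal of $KG$, regarded as a right $KG$-module. On $KG$ consider the inner product $\langle \sum_g a_g g,\sum_g b_g g\rangle=\sum_g a_gb_g$ and the Schur product $(\sum_g a_g g)*(\sum_g b_g g)=\sum_g a_gb_g\,g$. For a $G$-code $\mathcal C$ let $\mathcal C^\perp=\{v\in KG : \langle v,c\rangle=0 \text{ for all } c\in\mathcal C\}$, and let $\mathcal C*\mathcal C$ be the $K$-linear span of all products $c*c'$ with $c,c'\in\mathcal C$; it is again a $G$-code. Suppose that $\mathcal C$ is not self-orthogonal, i.e. $\mathcal C\not\subseteq\mathcal C^\perp$. Then $\mathcal C*\mathcal C=\mathcal P_0\oplus\mathcal M$ for some right $KG$-submodules $\mathcal P_0,\mathcal M$ of $\mathcal C*\mathcal C$ such that $\mathcal P_0$ is a projective cover of the trivial right $KG$-module $K_G$, that is, $\mathcal P_0$ is projective and there is a surjective $KG$-linear map $f:\mathcal P_0\to K_G$ whose kernel is superfluous (the only submodule $N\le \mathcal P_0$ with $N+\ker f=\mathcal P_0$ is $N=\mathcal P_0$). In particular, if $\operatorname{char}K=p$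 is a prime number, then $|G|_p\le\dim_K(\mathcal C*\mathcal C)$, where $|G|_p$ is the largest power of $p$ dividing $|G|$. -/

import Mathlib

namespace GroupCode

/-- A `G`-code over `K` is a right ideal of the group algebra `K G`: a submodule of `K G` for the
right regular action, where `MulOpposite.op a • x = x * a`. -/
abbrev Code (K G : Type*) [Field K] [Group G] : Type _ :=
  Submodule (MonoidAlgebra K G)ᵐᵒᵖ (MonoidAlgebra K G)

section Schur

variable {K G : Type*} [Field K] [Group G]

/-- The standard inner product on `K G`, for which the group elements are orthonormal. -/
def inner [Fintype G] (x y : MonoidAlgebra K G) : K :=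
  ∑ g : G, x.coeff g * y.coeff g

/-- The dual code, as a `K`-linear subspace of `K G`. -/
def dual [Fintype G] (C : Code K G) : Submodule K (MonoidAlgebra K G) where
  carrier := {v | ∀ c ∈ C, inner v c = 0}
  zero_mem' := by intro c _; simp [inner]
  add_mem' := by
    intro v w hv hw c hc
    have h1 := hv c hc
    have h2 := hw c hc
    simp only [inner] at h1 h2 ⊢
    simp [add_mul, Finset.sum_add_distrib, h1, h2]
  smul_mem' := by
    intro a v hv c hc
    have h1 := hv c hc
    simp only [inner] at h1 ⊢
    simp [mul_assoc, ← Finset.mul_sum, h1]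

/-- A code is self-orthogonal if it is contained in its dual. -/
def IsSelfOrthogonal [Fintype G] (C : Code K G) : Prop :=
  (C : Set (MonoidAlgebra K G)) ⊆ (dual C : Set (MonoidAlgebra K G))

/-- The Schur (coefficientwise) product of two elements of `K G`. -/
noncomputable def schur (x y : MonoidAlgebra K G) : MonoidAlgebra K G :=
  MonoidAlgebra.ofCoeff (x.coeff * y.coeff)

theorem schur_coeff {K G : Type*} [Field K] (x y : MonoidAlgebra K G) (g : G) :
    (schur x y).coeff g = x.coeff g * y.coeff g := rfl

/-- The `K`-linear span of the Schur products of elements of `C` with elements of `D`. -/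
noncomputable def schurSpan (C D : Code K G) : Submodule K (MonoidAlgebra K G) :=
  Submodule.span K {z | ∃ c ∈ C, ∃ d ∈ D, z = schur c d}

theorem schur_mul_single (x y : MonoidAlgebra K G) (g : G) (a : K) :
    schur x y * MonoidAlgebra.single g a =
      a • schur (x * MonoidAlgebra.single g 1) (y * MonoidAlgebra.single g 1) := by
  ext h
  simp [schur_coeff, MonoidAlgebra.coeff_mul_single_apply, mul_comm]

theorem schurSpan_mul_mem (C D : Code K G) (a x : MonoidAlgebra K G) (hx : x ∈ schurSpan C D) :
    x * a ∈ schurSpan C D := by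
  induction a using MonoidAlgebra.induction_linear with
  | zero => simp
  | add a b ha hb => rw [mul_add]; exact add_mem ha hb
  | single g r =>
    induction hx using Submodule.span_induction with
    | zero => simp
    | add u v _ _ hu hv => rw [add_mul]; exact add_mem hu hv
    | smul t u _ hu => rw [smul_mul_assoc]; exact Submodule.smul_mem _ t hu
    | mem z hz =>
      obtain ⟨c, hc, d, hd, rfl⟩ := hz
      rw [schur_mul_single]
      refine Submodule.smul_mem _ _ (Submodule.subset_span ⟨_, ?_, _, ?_, rfl⟩)
      · exact C.smul_mem (MulOpposite.op (MonoidAlgebra.single g 1)) hc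
      · exact D.smul_mem (MulOpposite.op (MonoidAlgebra.single g 1)) hd

/-- The Schur product `C * D` of two `G`-codes, which is again a `G`-code. -/
noncomputable def schurCode (C D : Code K G) : Code K G where
  toAddSubmonoid := (schurSpan C D).toAddSubmonoid
  smul_mem' := fun a x hx => schurSpan_mul_mem C D a.unop x hx

end Schur

section Trivial

variable (K G : Type*) [Field K] [Group G]

/-- The augmentation `∑ a_g g ↦ ∑ a_g` of the group algebra. -/
noncomputable def augmentation : MonoidAlgebra K G →ₐ[K] K :=
  MonoidAlgebra.lift K K G 1

/-- The underlying space `K` of the trivial right `K G`-module. -/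
@[nolint unusedArguments]
def Trivial (K G : Type*) [Field K] [Group G] : Type _ := K

instance : AddCommGroup (Trivial K G) := inferInstanceAs (AddCommGroup K)

/-- The trivial right `K G`-module: `a` acts on `K` as multiplication by its augmentation. -/
noncomputable instance : Module (MonoidAlgebra K G)ᵐᵒᵖ (Trivial K G) :=
  Module.compHom K ((augmentation K G : MonoidAlgebra K G →+* K).fromOpposite
    fun _ _ => Commute.all _ _)

end Trivial

/-- `f : P → M` is a projective cover of `M`: `P` is projective, and `f` is an epimorphism whose
kernel is superfluous. -/
structure IsProjectiveCover {R P M : Type*} [Ring R] [AddCommGroup P] [Module R P]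
    [AddCommGroup M] [Module R M] (f : P →ₗ[R] M) : Prop where
  projective : Module.Projective R P
  surjective : Function.Surjective f
  superfluous : ∀ N : Submodule R P, N ⊔ LinearMap.ker f = ⊤ → N = ⊤

end GroupCode

namespace GroupCode

open MonoidAlgebra MulOpposite

/-! The augmentation of `schur c c'` is the inner product of `c` and `c'`, so a code that is not
self-orthogonal has an element `d` of augmentation 1 in its Schur square. Fitting's lemma for left
multiplication by `d` gives a direct summand of `K G` inside that square still containing an element
of augmentation 1 (`exists_isCompl_le`). A minimal such summand is a projective cover: a submodule
that together with the kernel spans it has an element of augmentation 1, hence contains such a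
summand, hence is everything. For the dimension bound, `exists_mul_norm_ne_zero` finds `v` in the
summand not killed by the norm of a Sylow subgroup, and the translates of `v` by that subgroup are
linearly independent. -/

/-- A representation of a finite `p`-group on a nonzero vector space of characteristic `p` has a
nonzero fixed vector; here the representation space is any nonzero stable additive subgroup. -/
theorem exists_ne_zero_fixed {K V H : Type*} [Field K] [AddCommGroup V] [Module K V] [Group H]
    [Finite H] {p : ℕ} [Fact p.Prime] [CharP K p] (hH : IsPGroup p H) (ρ : Representation K H V)
    (W : AddSubgroup V) (hW : ∀ h, ∀ w ∈ W, ρ h w ∈ W) {v : V} (hv : v ∈ W) (hv0 : v ≠ 0) :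
    ∃ w ∈ W, w ≠ 0 ∧ ∀ h, ρ h w = w := by
  have hp : p.Prime := Fact.out
  have hpV : ∀ x : V, p • x = 0 := fun x => by
    rw [← Nat.cast_smul_eq_nsmul K, CharP.cast_eq_zero, zero_smul]
  -- `K` may be infinite, so fixed points are counted on the additive span of one orbit, which is
  -- finite because it is finitely generated and killed by `p`.
  let U : AddSubgroup V := AddSubgroup.closure (Set.range fun h => ρ h v)
  have hUW : U ≤ W := (AddSubgroup.closure_le _).2 <| by
    rintro _ ⟨h, rfl⟩
    exact hW h v hv
  have hU : ∀ h, ∀ u ∈ U, ρ h u ∈ U := by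
    intro h u hu
    induction hu using AddSubgroup.closure_induction with
    | mem x hx =>
      obtain ⟨k, rfl⟩ := hx
      exact AddSubgroup.subset_closure ⟨h * k, by simp⟩
    | zero => simp
    | add x y _ _ hx hy => rw [map_add]; exact add_mem hx hy
    | neg x _ hx => rw [map_neg]; exact neg_mem hx
  have hvU : v ∈ U := AddSubgroup.subset_closure ⟨1, by simp⟩
  have : AddGroup.FG U := (AddGroup.fg_iff_addSubgroup_fg U).2 ⟨(Set.finite_range fun h => ρ h v).toFinset,
    by simp [U]⟩
  have : Finite U := AddCommGroup.finite_of_fg_isAddTorsion U fun u =>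
    isOfFinAddOrder_iff_nsmul_eq_zero.2 ⟨p, hp.pos, Subtype.ext (hpV u)⟩
  let _ : MulAction H U :=
    { smul h u := ⟨ρ h u, hU h u u.2⟩
      one_smul u := Subtype.ext (by change ρ 1 (u : V) = u; simp)
      mul_smul h k u := Subtype.ext (by change ρ (h * k) (u : V) = ρ h (ρ k u); simp) }
  have hsmul : ∀ (h : H) (u : U), ((h • u : U) : V) = ρ h u := fun _ _ => rfl
  have hdvd : p ∣ Nat.card U := by
    have hord : addOrderOf (⟨v, hvU⟩ : U) = p :=
      addOrderOf_eq_prime (Subtype.ext (hpV v)) fun h => hv0 (congrArg Subtype.val h)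
    exact hord ▸ addOrderOf_dvd_natCard _
  obtain ⟨w, hw, hw0⟩ := hH.exists_fixed_point_of_prime_dvd_card_of_fixed_point U hdvd
    (a := 0) fun h => Subtype.ext (by simp [hsmul])
  refine ⟨w, hUW w.2, fun h => hw0 (Subtype.ext h.symm), fun h => ?_⟩
  rw [← hsmul, hw h]

/-! ### Norms of `p`-subgroups and the dimension bound -/

variable {K G : Type*} [Field K] [Group G]

/-- The right regular representation of `G` on `K G`, restricted to a subgroup. -/
noncomputable def rightRegular (K : Type*) [Field K] (H : Subgroup G) :
    Representation K H (MonoidAlgebra K G) where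
  toFun h := LinearMap.mulRight K (single (h⁻¹ : G) 1)
  map_one' := LinearMap.ext fun x => by simp [← one_def]
  map_mul' h k := by
    refine LinearMap.ext fun x => ?_
    simp [mul_assoc, single_mul_single]

theorem rightRegular_apply (H : Subgroup G) (h : H) (x : MonoidAlgebra K G) :
    rightRegular K H h x = x * single (h⁻¹ : G) 1 := rfl

theorem coeff_mul_right_of_fixed {H : Subgroup G} {x : MonoidAlgebra K G}
    (hx : ∀ h, rightRegular K H h x = x) (g : G) {h : G} (hh : h ∈ H) :
    x.coeff (g * h) = x.coeff g := by
  have := congrArg (fun y => y.coeff g) (hx ⟨h, hh⟩)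
  simpa [rightRegular_apply, coeff_mul_single_apply] using this

/-- The sum of the elements of a subgroup. -/
noncomputable def norm (K : Type*) [Field K] (H : Subgroup G) [Fintype H] : MonoidAlgebra K G :=
  ∑ h : H, single (h : G) 1

theorem mul_norm_coeff (H : Subgroup G) [Fintype H] (w : MonoidAlgebra K G) (g : G) :
    (w * norm K H).coeff g = ∑ h : H, w.coeff (g * (h⁻¹ : G)) := by
  simp [norm, Finset.mul_sum, coeff_mul_single_apply]

/-- Elements of `K G` fixed by `H` on the right are right multiples of the norm of `H`. -/
theorem exists_eq_mul_norm [Finite G] {H : Subgroup G} [Fintype H] {x : MonoidAlgebra K G}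
    (hx : ∀ h, rightRegular K H h x = x) : ∃ w, x = w * norm K H := by
  classical
  let r : G → G := fun g => (QuotientGroup.mk g : G ⧸ H).out
  have hr : ∀ g h, h ∈ H → r (g * h) = r g := fun g h hh => by
    simp only [r, QuotientGroup.mk_mul_of_mem g hh]
  have hrm : ∀ g, g⁻¹ * r g ∈ H := fun g =>
    QuotientGroup.eq.1 (QuotientGroup.out_eq' (g : G ⧸ H)).symm
  -- Keep the coefficients of `x` at one representative of each left coset; the norm spreads them
  -- over the cosets.
  refine ⟨ofCoeff (Finsupp.equivFunOnFinite.symm fun g => if r g = g then x.coeff g else 0), ?_⟩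
  ext g
  rw [mul_norm_coeff, Finset.sum_eq_single (⟨(r g)⁻¹ * g, by simpa using inv_mem (hrm g)⟩ : H)]
  · have h1 : r (r g) = r g := by simpa using hr g _ (hrm g)
    have h2 := coeff_mul_right_of_fixed hx g (hrm g)
    simp only [mul_inv_cancel_left] at h2
    simp [h1, h2]
  · rintro h - hne
    have : r (g * (h⁻¹ : G)) = r g := hr g _ (inv_mem h.2)
    simp only [Finsupp.equivFunOnFinite_symm_apply_apply, this]
    refine if_neg fun he => hne (Subtype.ext ?_)
    simp [he]
  · simp

theorem eq_smul_norm {H : Subgroup G} [Fintype H] {x : MonoidAlgebra K G}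
    (hx : ∀ h, rightRegular K H h x = x) (hs : ∀ g ∉ H, x.coeff g = 0) :
    x = x.coeff 1 • norm K H := by
  classical
  ext g
  rw [norm, coeff_smul, coeff_sum]
  simp only [Finsupp.smul_apply, Finsupp.finsetSum_apply, coeff_single, Finsupp.single_apply]
  by_cases hg : g ∈ H
  · rw [Finset.sum_eq_single ⟨g, hg⟩ (fun h _ hne => if_neg fun he => hne (Subtype.ext he))
      (by simp)]
    simpa using coeff_mul_right_of_fixed hx 1 hg
  · rw [Finset.sum_eq_zero fun (h : H) _ => if_neg fun he : (h : G) = g => hg (he ▸ h.2), hs g hg, smul_zero]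

/-- A relation is an element of `K H` annihilated by `v` on the left. Such elements are stable under
right translation by `H`, so if any is nonzero, a nonzero fixed one exists; it is a multiple of the
norm, which `v` does not annihilate. -/
theorem linearIndependent_mul_single {p : ℕ} [Fact p.Prime] [CharP K p]
    {H : Subgroup G} [Fintype H] (hH : IsPGroup p H) {v : MonoidAlgebra K G} (hv : v * norm K H ≠ 0) :
    LinearIndependent K fun h : H => v * single (h : G) 1 := by
  classical
  rw [Fintype.linearIndependent_iff]
  intro c hc
  let x : MonoidAlgebra K G := ∑ h : H, single (h : G) (c h)
  have hvx : v * x = 0 := by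
    rw [← hc, Finset.mul_sum]
    refine Finset.sum_congr rfl fun h _ => ?_
    rw [← mul_smul_comm, smul_single', mul_one]
  have hx : ∀ g ∉ H, x.coeff g = 0 := fun g hg => by
    simp only [x, coeff_sum, Finsupp.finsetSum_apply, coeff_single, Finsupp.single_apply]
    exact Finset.sum_eq_zero fun (h : H) _ => if_neg fun he : (h : G) = g => hg (he ▸ h.2)
  have hx0 : x = 0 := by
    by_contra hx0
    let W : AddSubgroup (MonoidAlgebra K G) :=
      { carrier := {y | v * y = 0 ∧ ∀ g ∉ H, y.coeff g = 0}
        zero_mem' := by simp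
        add_mem' := by
          rintro a b ⟨ha, ha'⟩ ⟨hb, hb'⟩
          exact ⟨by rw [mul_add, ha, hb, add_zero], fun g hg => by simp [ha' g hg, hb' g hg]⟩
        neg_mem' := by
          rintro a ⟨ha, ha'⟩
          exact ⟨by rw [mul_neg, ha, neg_zero], fun g hg => by simp [ha' g hg]⟩ }
    obtain ⟨y, ⟨hvy, hys⟩, hy0, hfix⟩ := exists_ne_zero_fixed hH (rightRegular K H) W
      (fun h w hw => by
        refine ⟨by rw [rightRegular_apply, ← mul_assoc, hw.1, zero_mul], fun g hg => ?_⟩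
        rw [rightRegular_apply, coeff_mul_single_apply, hw.2, zero_mul]
        simpa using mt (fun h' => (H.mul_mem_cancel_right h.2).1 h') hg) ⟨hvx, hx⟩ hx0
    have hy := eq_smul_norm hfix hys
    rw [hy, mul_smul_comm, smul_eq_zero] at hvy
    refine hvy.elim (fun h0 => hy0 ?_) hv
    rw [hy, h0, zero_smul]
  intro h
  have : x.coeff h = c h := by
    simp only [x, coeff_sum, Finsupp.finsetSum_apply, coeff_single, Finsupp.single_apply]
    rw [Finset.sum_eq_single h (fun k _ hne => if_neg fun he => hne (Subtype.ext he)) (by simp),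
      if_pos rfl]
  rw [← this, hx0]; simp

theorem mul_mem_code (P : Code K G) {x : MonoidAlgebra K G} (hx : x ∈ P) (a : MonoidAlgebra K G) :
    x * a ∈ P := P.smul_mem (op a) hx

theorem map_mul_code {P : Code K G}
    (π : MonoidAlgebra K G →ₗ[(MonoidAlgebra K G)ᵐᵒᵖ] P) (x a : MonoidAlgebra K G) :
    (π (x * a) : MonoidAlgebra K G) = π x * a :=
  congrArg Subtype.val (π.map_smul (op a) x)

/-- A nonzero direct summand of the right regular module has a vector not killed by the norm of a
`p`-subgroup, in characteristic `p`. -/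
theorem exists_mul_norm_ne_zero [Finite G] {p : ℕ} [Fact p.Prime] [CharP K p] {H : Subgroup G}
    [Fintype H] (hH : IsPGroup p H) {P Q : Code K G} (hPQ : IsCompl P Q) (hP : P ≠ ⊥) :
    ∃ v ∈ P, v * norm K H ≠ 0 := by
  obtain ⟨u, hu, hu0⟩ := P.exists_mem_ne_zero_of_ne_bot hP
  obtain ⟨y, hyP, hy0, hfix⟩ := exists_ne_zero_fixed hH (rightRegular K H) P.toAddSubgroup
    (fun h w hw => mul_mem_code P hw _) hu hu0
  obtain ⟨w, rfl⟩ := exists_eq_mul_norm hfix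
  let π := P.projectionOnto Q hPQ
  -- `w` need not lie in `P`, but `π` is right linear and fixes `w * norm K H`.
  refine ⟨π w, (π w).2, fun h => hy0 ?_⟩
  rw [← map_mul_code] at h
  rw [← h]
  exact (congrArg Subtype.val (Submodule.projectionOnto_apply_left hPQ ⟨_, hyP⟩)).symm

/-- A nonzero direct summand of the right regular module has dimension at least the order of any
`p`-subgroup, in characteristic `p`. -/
theorem card_le_finrank [Finite G] {p : ℕ} [Fact p.Prime] [CharP K p] {H : Subgroup G}
    (hH : IsPGroup p H) {P Q : Code K G} (hPQ : IsCompl P Q) (hP : P ≠ ⊥)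
    (S : Submodule K (MonoidAlgebra K G)) (hS : ∀ x ∈ P, x ∈ S) :
    Nat.card H ≤ Module.finrank K S := by
  have := Fintype.ofFinite H
  obtain ⟨v, hvP, hv⟩ := exists_mul_norm_ne_zero hH hPQ hP
  have hli : LinearIndependent K fun h : H =>
      (⟨v * single (h : G) 1, hS _ (mul_mem_code P hvP _)⟩ : S) :=
    LinearIndependent.of_comp S.subtype (linearIndependent_mul_single hH hv)
  simpa using hli.fintype_card_le_finrank

/-! ### Augmentation, Fitting summands and projective covers -/

/-- The augmentation as a homomorphism of right modules. -/
noncomputable def augmentationRight (K G : Type*) [Field K] [Group G] :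
    MonoidAlgebra K G →ₗ[(MonoidAlgebra K G)ᵐᵒᵖ] Trivial K G where
  toFun x := (augmentation K G x : K)
  map_add' x y := map_add (augmentation K G) x y
  map_smul' a x := (map_mul (augmentation K G) x a.unop).trans (mul_comm _ _)

instance [Finite G] : IsNoetherian (MonoidAlgebra K G)ᵐᵒᵖ (MonoidAlgebra K G) :=
  isNoetherian_of_tower K inferInstance

instance [Finite G] : IsArtinian (MonoidAlgebra K G)ᵐᵒᵖ (MonoidAlgebra K G) :=
  isArtinian_of_tower K inferInstance

/-- A code with an element of augmentation one contains a direct summand of the right regular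
module with the same property. -/
theorem exists_isCompl_le [Finite G] {D : Code K G} {d : MonoidAlgebra K G} (hd : d ∈ D)
    (hd1 : augmentation K G d = 1) :
    ∃ P Q : Code K G, P ≤ D ∧ IsCompl P Q ∧ ∃ e ∈ P, augmentation K G e = 1 := by
  let L : Module.End (MonoidAlgebra K G)ᵐᵒᵖ (MonoidAlgebra K G) :=
    { toFun x := d * x
      map_add' := mul_add d
      map_smul' a x := (mul_assoc d x a.unop).symm }
  have hL : ∀ n x, (L ^ n) x = d ^ n * x := fun n => by
    induction n with
    | zero => simp
    | succ n ih =>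
      intro x
      rw [pow_succ, Module.End.mul_apply, ih, pow_succ, mul_assoc]
      rfl
  -- The bound `1 ≤ n` puts the range of `L ^ n` inside `D`.
  obtain ⟨n, hn, hn1⟩ := (L.eventually_isCompl_ker_pow_range_pow.and
    (Filter.eventually_ge_atTop 1)).exists
  refine ⟨(L ^ n).range, (L ^ n).ker, ?_, hn.symm, d ^ n, ⟨1, by simp [hL]⟩, by simp [hd1]⟩
  rintro _ ⟨x, rfl⟩
  obtain ⟨m, rfl⟩ := Nat.exists_eq_add_of_le hn1
  rw [hL, pow_add, pow_one, mul_assoc]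
  exact mul_mem_code D hd _

theorem exists_augmentation_eq_one {D : Code K G} {x : MonoidAlgebra K G} (hx : x ∈ D)
    (hx0 : augmentation K G x ≠ 0) : ∃ d ∈ D, augmentation K G d = 1 := by
  refine ⟨x * single 1 (augmentation K G x)⁻¹, mul_mem_code D hx _, ?_⟩
  rw [map_mul]
  simp [augmentation] at hx0 ⊢
  exact mul_inv_cancel₀ hx0

instance : Module.Projective (MonoidAlgebra K G)ᵐᵒᵖ (MonoidAlgebra K G) :=
  Module.Projective.of_equiv
    ({ opAddEquiv.symm with
        map_smul' := fun _ _ => rfl } :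
      (MonoidAlgebra K G)ᵐᵒᵖ ≃ₗ[(MonoidAlgebra K G)ᵐᵒᵖ] MonoidAlgebra K G)

theorem projective_of_isCompl {P Q : Code K G} (hPQ : IsCompl P Q) :
    Module.Projective (MonoidAlgebra K G)ᵐᵒᵖ P :=
  .of_split P.subtype (P.projectionOnto Q hPQ) <|
    LinearMap.ext (Submodule.projectionOnto_apply_left hPQ)

/-- A code with an element of augmentation one contains a direct summand of the right regular
module on which the augmentation is a projective cover of the trivial module. -/
theorem exists_isProjectiveCover [Finite G] {D : Code K G} {d : MonoidAlgebra K G} (hd : d ∈ D)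
    (hd1 : augmentation K G d = 1) :
    ∃ P Q : Code K G, P ≤ D ∧ IsCompl P Q ∧ P ≠ ⊥ ∧
      IsProjectiveCover (augmentationRight K G ∘ₗ P.subtype) := by
  obtain ⟨P, ⟨hPD, ⟨Q, hPQ⟩, e, heP, he⟩, hmin⟩ := IsArtinian.set_has_minimal
    {P : Code K G | P ≤ D ∧ (∃ Q, IsCompl P Q) ∧ ∃ e ∈ P, augmentation K G e = 1} <| by
      obtain ⟨P, Q, hPD, hPQ, he⟩ := exists_isCompl_le hd hd1
      exact ⟨P, hPD, ⟨Q, hPQ⟩, he⟩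
  refine ⟨P, Q, hPD, hPQ, ?_, projective_of_isCompl hPQ, fun k => ?_, fun N hN => ?_⟩
  · rintro rfl
    rw [Submodule.mem_bot] at heP
    simp [heP] at he
  · refine ⟨⟨e * single 1 (show K from k), mul_mem_code P heP _⟩, ?_⟩
    change augmentation K G (e * single 1 (show K from k)) = (show K from k)
    rw [map_mul, he, one_mul]
    exact (lift_single _ _ _).trans (mul_one _)
  · obtain ⟨y, hy, z, hz, hyz⟩ := Submodule.mem_sup.1 
      (hN.symm ▸ Submodule.mem_top : (⟨e, heP⟩ : P) ∈ N ⊔ _)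
    have hy1 : augmentation K G (y : MonoidAlgebra K G) = 1 := by
      have hz0 : augmentation K G (z : MonoidAlgebra K G) = 0 := hz
      have hyz' : (y + z : MonoidAlgebra K G) = e := congrArg Subtype.val hyz
      rw [← he, ← hyz']
      simp [hz0]
    obtain ⟨P', Q', hP', hPQ', he'⟩ := exists_isCompl_le
      (D := N.map P.subtype) (Submodule.mem_map_of_mem hy) hy1
    have hle : N.map P.subtype ≤ P := Submodule.map_subtype_le P N
    have hPN : P ≤ N.map P.subtype := by
      have hP'P := hP'.trans hle
      exact (hP'P.eq_of_not_lt (hmin P' ⟨hP'P.trans hPD, ⟨Q', hPQ'⟩, he'⟩)).ge.trans hP'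
    refine eq_top_iff.2 fun x _ => ?_
    obtain ⟨n, hn, hnx⟩ := hPN x.2
    exact Subtype.ext hnx ▸ hn

theorem augmentation_schur [Fintype G] (x y : MonoidAlgebra K G) :
    augmentation K G (schur x y) = inner x y := by
  simp [augmentation, lift_apply, Finsupp.sum_fintype, schur_coeff, inner]

end GroupCode

theorem theorem3p6 {K G : Type*} [Field K] [Group G] [Fintype G]
    (C : GroupCode.Code K G) (hC : ¬ GroupCode.IsSelfOrthogonal C) :
    (∃ P M : GroupCode.Code K G,
      P ⊔ M = GroupCode.schurCode C C ∧ Disjoint P M ∧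
      ∃ f : P →ₗ[(MonoidAlgebra K G)ᵐᵒᵖ] GroupCode.Trivial K G,
        GroupCode.IsProjectiveCover f) ∧
    (∀ p : ℕ, p.Prime → CharP K p →
      p ^ (Nat.card G).factorization p ≤ Module.finrank K (GroupCode.schurSpan C C)) := by
  obtain ⟨c, hc, c', hc', hcc⟩ : ∃ c ∈ C, ∃ c' ∈ C, GroupCode.inner c c' ≠ 0 := by
    by_contra! h
    exact hC h
  have hmem : GroupCode.schur c c' ∈ GroupCode.schurCode C C :=
    Submodule.subset_span ⟨c, hc, c', hc', rfl⟩
  obtain ⟨d, hd, hd1⟩ := GroupCode.exists_augmentation_eq_one hmem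
    (by rwa [GroupCode.augmentation_schur])
  obtain ⟨P, Q, hPD, hPQ, hP0, hcover⟩ := GroupCode.exists_isProjectiveCover hd hd1
  refine ⟨⟨P, Q ⊓ GroupCode.schurCode C C, ?_, hPQ.disjoint.mono_right inf_le_left, _, hcover⟩,
    fun p hp _ => ?_⟩
  -- Modular law, as `P` lies in the Schur square.
  · rw [← sup_inf_assoc_of_le Q hPD, hPQ.sup_eq_top, top_inf_eq]
  · have : Fact p.Prime := ⟨hp⟩
    obtain ⟨H⟩ : Nonempty (Sylow p G) := inferInstance
    rw [← H.card_eq_multiplicity]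
    exact GroupCode.card_le_finrank H.isPGroup' hPQ hP0 _ fun x hx => hPD hx
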